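/- **Setting.** For $n\ge 1$ let $X_n=\{x_{i,n}=-1+\frac{2}{n}i : i=0,\dots,n\}$ and $m=\big\lfloor \frac{\pi}{\sqrt2}\sqrt n\big\rfloor$. Let $X'\subset X_n$ be a mock-Chebyshev subset of $m+1$ distinct nodes $x'_0,\dots,x'_m$, where $x'_j$ is a point of $X_n$ nearest to the Chebyshev–Lobatto node $-\cos(\pi j/m)$, and let $X''=X_n\setminus X'$. Put $\omega_m(t)=\prod_{i=0}^m (t-x'_i)$ and, for $x''_k\in X''$, $w_k=\omega_m(x''_k)^2$. Write $\mathcal P^{r}$ for the real polynomials of degree $\le r$, $\|\cdot\|_\infty$ for the uniform norm on $[-1,1]$, $E_p(g)=\inf_{Q\in\mathcal P^p}\|g-Q\|_\infty$, and, for $d>0$, $$F_{d,p}=\{f\in C^p[-1,1] : \|f^{(p)}\|_\infty\le d\}.$$ For a function $f$ let $P_{X'}\in\mathcal P^m$ be the polynomial interpolating $f$ on $X'$, and let $\hat f=(f-P_{X'})/\omega_m$ on $[-1,1]$, extended to the points of $X'$ by its limits. The constrained mock-Chebyshev least-squares approximant $\hat P_X$ with regression degree $p$ is the minimizer of $\sum_{x\in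 X''}(f(x)-P(x))^2$ over all $P\in\mathcal P^{m+p+1}$ with $P=f$ on $X'$. **Theorem.** Let $d>0$ and let $p\ge 1$ be an integer. There is a constant $D>0$, depending only on $d$ and $p$, with $E_p(\varphi)\le D\,(p+1)^{-p}$ for all $\varphi\in F_{d,p}$, such that the following holds for every $n\ge1$, every mock-Chebyshev subset $X'$ of $X_n$ as above, every set $X'''=\{x'''_0,\dots,x'''_p\}\subset X''$ of $p+1$ distinct nodes, and every $f\in F_{d,p}$. Let $\|I_p\|$ be the norm, as an operator on $C[-1,1]$ with the uniform norm, of polynomial interpolation of degree $\le p$ at the nodes of $X'''$, and let $\tilde w_j=\omega_m(x'''_j)^2$. Then $\hat P_X$ exists and is unique, and $$\|f-\hat P_X\|_\infty\le\left(1+\|I_p\|\left(1+D\,\frac{\big(\sum_{k} w_k\big)^{1/2}}{\min_{0\le j\le p}\sqrt{\tilde w_j}}\,(p+1)^{-p}\right)\right)E_p(\hat f)\,\|\omega_m\|_\infty .$$ In particular this applies to $p=\big\lfloor\frac{\pi}{\sqrt2}\sqrt{n/6}\big\rfloor$ (when it is at least $1$ and $X''$ has at least $p+1$ points) and to a set $X'''$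 of $p+1$ nodes of $X''$ selected in the mock-Chebyshev sense. -/

import Mathlib

open Polynomial

noncomputable section

namespace MockChebyshev

/-- The interval `[-1, 1]` as a type. -/
abbrev Seg : Type := Set.Icc (-1 : ℝ) 1

/-- The equispaced nodes `x_{i,n} = -1 + (2/n) i` of `[-1, 1]`, for `i = 0, ..., n`. -/
def node (n : ℕ) (i : Fin (n + 1)) : ℝ := -1 + 2 / (n : ℝ) * (i : ℝ)

theorem node_mem (n : ℕ) (i : Fin (n + 1)) : node n i ∈ Set.Icc (-1 : ℝ) 1 := by
  have hi : ((i : ℕ) : ℝ) ≤ (n : ℝ) := by exact_mod_cast Nat.lt_succ_iff.mp i.2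
  have h0 : (0 : ℝ) ≤ 2 / (n : ℝ) * (i : ℝ) := by positivity
  have h2 : 2 / (n : ℝ) * (i : ℝ) ≤ 2 := by
    rcases Nat.eq_zero_or_pos n with h | h
    · subst h; simp
    · have hn : (0 : ℝ) < (n : ℝ) := by exact_mod_cast h
      rw [div_mul_eq_mul_div, div_le_iff₀ hn]
      linarith
  unfold node
  constructor <;> linarith

/-- The `m + 1` Chebyshev-Lobatto nodes `-cos (π j / m)`, for `j = 0, ..., m`. -/
def lobattoNode (m : ℕ) (j : Fin (m + 1)) : ℝ := -Real.cos (Real.pi / (m : ℝ) * (j : ℝ))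

/-- `m = ⌊(π / √2) √n⌋`. -/
def mockDegree (n : ℕ) : ℕ := ⌊Real.pi / Real.sqrt 2 * Real.sqrt (n : ℝ)⌋₊

/-- A set of nodes of the equispaced grid, given by its set `S` of indices, is a mock-Chebyshev
subset: it consists of `m + 1` distinct nodes, the `j`-th of which is a grid point nearest
to the `j`-th Chebyshev-Lobatto node (any nearest grid point may be chosen in case of a tie). -/
def IsMockChebyshevSubset (n : ℕ) (S : Finset (Fin (n + 1))) : Prop :=
  ∃ σ : Fin (mockDegree n + 1) → Fin (n + 1),
    Function.Injective σ ∧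
    (∀ (j : Fin (mockDegree n + 1)) (i : Fin (n + 1)),
      |node n (σ j) - lobattoNode (mockDegree n) j| ≤
        |node n i - lobattoNode (mockDegree n) j|) ∧
    S = Finset.univ.image σ

/-- The uniform norm on `[-1, 1]` (of a function that is bounded there). -/
def supNorm (g : ℝ → ℝ) : ℝ := ⨆ t : Seg, |g t|

/-- `E_p(g)`, the error of best uniform approximation of `g` on `[-1, 1]` by
polynomials of degree at most `p`. -/
def bestApproxError (p : ℕ) (g : ℝ → ℝ) : ℝ :=
  ⨅ Q : {Q : ℝ[X] // Q.natDegree ≤ p}, supNorm (fun t => g t - (Q : ℝ[X]).eval t)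

/-- The class `F_{d,k}` of the functions in `C^k[-1,1]` whose `k`-th derivative is bounded by `d`
in absolute value. -/
def smoothClass (d : ℝ) (k : ℕ) : Set (ℝ → ℝ) :=
  {f | ContDiffOn ℝ k f (Set.Icc (-1) 1) ∧
    ∀ t ∈ Set.Icc (-1 : ℝ) 1, |iteratedDerivWithin k f (Set.Icc (-1) 1) t| ≤ d}

/-- The nodal polynomial `ω(t) = ∏_{i ∈ S} (t - x_i)`. -/
def nodalPoly (n : ℕ) (S : Finset (Fin (n + 1))) : ℝ[X] := Lagrange.nodal S (node n)

/-- The polynomial of degree less than `#S` that interpolates `f` at the nodes of `S`. -/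
def interpPoly (n : ℕ) (S : Finset (Fin (n + 1))) (f : ℝ → ℝ) : ℝ[X] :=
  Lagrange.interpolate S (node n) (fun i => f (node n i))

open Classical in
/-- The quotient `(f - P_S) / ω_S` on `[-1, 1]`; at a node of `S`, where both terms vanish,
it takes its limit value `(f' - P_S') / ω_S'`. -/
def quotientFun (n : ℕ) (S : Finset (Fin (n + 1))) (f : ℝ → ℝ) (t : ℝ) : ℝ :=
  if t ∈ S.image (node n) then
    (derivWithin f (Set.Icc (-1) 1) t - (derivative (interpPoly n S f)).eval t) /
      (derivative (nodalPoly n S)).eval t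
  else
    (f t - (interpPoly n S f).eval t) / (nodalPoly n S).eval t

/-- The weights `w_k = ω_S(x_k)²`. -/
def weight (n : ℕ) (S : Finset (Fin (n + 1))) (k : Fin (n + 1)) : ℝ :=
  ((nodalPoly n S).eval (node n k)) ^ 2

/-- The interpolation operator `φ ↦ ∑_{j ∈ T} φ(x_j) l_j` at the nodes of `T`, where the `l_j` are
the Lagrange basis polynomials, as a bounded operator on `C[-1,1]` with the uniform norm. -/
def interpOp (n : ℕ) (T : Finset (Fin (n + 1))) : C(Seg, ℝ) →L[ℝ] C(Seg, ℝ) :=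
  ∑ j ∈ T, (ContinuousMap.evalCLM ℝ (⟨node n j, node_mem n j⟩ : Seg)).smulRight
    ((Lagrange.basis T (node n) j).toContinuousMapOn (Set.Icc (-1) 1))

/-- `P` belongs to `P^{r*}`: it has degree at most `r` and interpolates `f` at the nodes of `S`. -/
def IsAdmissible (n : ℕ) (S : Finset (Fin (n + 1))) (f : ℝ → ℝ) (r : ℕ) (P : ℝ[X]) : Prop :=
  P.natDegree ≤ r ∧ ∀ i ∈ S, P.eval (node n i) = f (node n i)

/-- `P` solves the constrained least-squares problem of degree `r`: among the polynomials of degree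
at most `r` that interpolate `f` at the nodes of `S`, it minimizes the sum of the squared errors at
the remaining nodes of the grid. -/
def IsConstrainedLeastSquares (n : ℕ) (S : Finset (Fin (n + 1))) (f : ℝ → ℝ) (r : ℕ)
    (P : ℝ[X]) : Prop :=
  IsAdmissible n S f r P ∧
    ∀ R : ℝ[X], IsAdmissible n S f r R →
      ∑ k ∈ Sᶜ, (f (node n k) - P.eval (node n k)) ^ 2 ≤
        ∑ k ∈ Sᶜ, (f (node n k) - R.eval (node n k)) ^ 2

end MockChebyshev

end

noncomputable section

namespace MockChebyshev

/-! Write `ω` for the nodal polynomial of `X'` and `g` for the quotient `(f - P_{X'}) / ω`.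
Admissible polynomials are exactly `P_{X'} + ω q` with `deg q ≤ p`, and their error is `ω (g - q)`,
so the constrained problem is an unconstrained least-squares fit of `g` with weights `ω²`. Let `q`
be the minimizer, `Q` any competitor and `E = ‖g - Q‖`. Minimality gives `∑ w (g - q)² ≤ (∑ w) E²`.
Keeping a single term bounds `|g - q|` on `X'''` by `A E`, where `A = √(∑ w) / min √w̃`. There `|Q -
q| ≤ (1 + A) E`, and `Q - q` is its own interpolant, so `‖Q - q‖ ≤ ‖I_p‖ (1 + A) E`. The triangle
inequality and the infimum over `Q` finish (`IsConstrainedLeastSquares.abs_sub_eval_le`). This is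
the claim with `D (p+1)^(-p)` replaced by `1`, so it suffices that `D (p+1)^(-p)` be at least `1`
and dominate the Taylor bound for `E_p` on the smooth class. -/

theorem node_injective {n : ℕ} (hn : 0 < n) : Function.Injective (node n) := by
  intro i j h
  have hn' : (n : ℝ) ≠ 0 := by exact_mod_cast hn.ne'
  unfold node at h
  have h1 : 2 / (n : ℝ) * (i : ℝ) = 2 / (n : ℝ) * (j : ℝ) := by linarith
  have h2 : ((i : ℕ) : ℝ) = ((j : ℕ) : ℝ) := mul_left_cancel₀ (by positivity) h1
  exact Fin.ext (by exact_mod_cast h2)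

/-! ### Uniform norm and best approximation -/

theorem supNorm_nonneg (g : ℝ → ℝ) : 0 ≤ supNorm g := Real.iSup_nonneg fun _ => abs_nonneg _

theorem supNorm_le {g : ℝ → ℝ} {M : ℝ} (h : ∀ t ∈ Set.Icc (-1 : ℝ) 1, |g t| ≤ M) :
    supNorm g ≤ M := by
  have : Nonempty Seg := ⟨⟨0, by norm_num, by norm_num⟩⟩
  exact ciSup_le fun t => h t t.2

/-- Continuity supplies the boundedness without which the real supremum would default to `0`. -/
theorem le_supNorm {g : ℝ → ℝ} (hg : ContinuousOn g (Set.Icc (-1 : ℝ) 1)) {t : ℝ}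
    (ht : t ∈ Set.Icc (-1 : ℝ) 1) : |g t| ≤ supNorm g := by
  obtain ⟨M, hM⟩ := isCompact_Icc.exists_bound_of_continuousOn hg
  refine le_ciSup (f := fun t : Seg => |g t|) ⟨M, ?_⟩ ⟨t, ht⟩
  rintro _ ⟨s, rfl⟩
  exact hM s s.2

theorem bestApproxError_le {p : ℕ} {g : ℝ → ℝ} {Q : ℝ[X]} (hQ : Q.natDegree ≤ p) :
    bestApproxError p g ≤ supNorm (fun t => g t - Q.eval t) :=
  ciInf_le (f := fun Q : {Q : ℝ[X] // Q.natDegree ≤ p} => supNorm (fun t => g t - Q.1.eval t))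
    ⟨0, by rintro _ ⟨Q, rfl⟩; exact supNorm_nonneg _⟩ ⟨Q, hQ⟩

theorem le_mul_bestApproxError {p : ℕ} {g : ℝ → ℝ} {a c : ℝ} (hc : 0 ≤ c)
    (h : ∀ Q : ℝ[X], Q.natDegree ≤ p → a ≤ c * supNorm (fun t => g t - Q.eval t)) :
    a ≤ c * bestApproxError p g := by
  have : Nonempty {Q : ℝ[X] // Q.natDegree ≤ p} := ⟨⟨0, by simp⟩⟩
  unfold bestApproxError
  rw [Real.mul_iInf_of_nonneg hc]
  exact le_ciInf fun Q => h Q.1 Q.2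

/-- Approximating by a Taylor polynomial bounds the best approximation error of a smooth class. -/
theorem bestApproxError_le_of_mem_smoothClass {d : ℝ} (hd : 0 < d) {p : ℕ} (hp : 1 ≤ p)
    {φ : ℝ → ℝ} (hφ : φ ∈ smoothClass d p) : bestApproxError p φ ≤ d * 2 ^ p := by
  -- The Taylor polynomial of order `p - 1` at `-1` has a remainder controlled by the `p`-th
  -- derivative; `2` is the length of the interval.
  obtain ⟨k, rfl⟩ : ∃ k, p = k + 1 := ⟨p - 1, by omega⟩
  set Q : ℝ[X] := ∑ i ∈ Finset.range (k + 1),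
    C ((Nat.factorial i : ℝ)⁻¹ * iteratedDerivWithin i φ (Set.Icc (-1) 1) (-1)) *
      (X - C (-1 : ℝ)) ^ i with hQ
  have hQdeg : Q.natDegree ≤ k + 1 := by
    refine natDegree_sum_le_of_forall_le _ _ fun i hi => ?_
    refine (natDegree_C_mul_le _ _).trans ((natDegree_pow_le).trans ?_)
    rw [natDegree_X_sub_C]
    have := Finset.mem_range.mp hi
    omega
  refine (bestApproxError_le hQdeg).trans (supNorm_le fun t ht => ?_)
  have hT : taylorWithinEval φ k (Set.Icc (-1) 1) (-1) t = Q.eval t := by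
    rw [taylor_within_apply, hQ, eval_finsetSum]
    refine Finset.sum_congr rfl fun i _ => ?_
    simp only [eval_mul, eval_C, eval_pow, eval_sub, eval_X, smul_eq_mul]
    ring
  have h := taylor_mean_remainder_bound (n := k) (by norm_num : (-1 : ℝ) ≤ 1)
    (by exact_mod_cast hφ.1) ht hφ.2
  rw [hT, Real.norm_eq_abs] at h
  have h0 : 0 ≤ t - -1 := by linarith [ht.1]
  have h2 : (t - -1) ^ (k + 1) ≤ 2 ^ (k + 1) := pow_le_pow_left₀ h0 (by linarith [ht.2]) _
  have hf : (1 : ℝ) ≤ (Nat.factorial k : ℝ) := by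
    exact_mod_cast k.factorial_pos
  calc _ ≤ _ := h
    _ ≤ d * (t - -1) ^ (k + 1) := div_le_self (by positivity) hf
    _ ≤ _ := by gcongr

/-! ### Interpolation, nodal polynomial and quotient -/

theorem eval_interpPoly {n : ℕ} (hn : 0 < n) {S : Finset (Fin (n + 1))} (f : ℝ → ℝ)
    {i : Fin (n + 1)} (hi : i ∈ S) : (interpPoly n S f).eval (node n i) = f (node n i) :=
  Lagrange.eval_interpolate_at_node _ (node_injective hn).injOn hi

/-- One more than the sharp bound for nonempty `S`, but valid for empty `S` too and sufficient,
since admissible degrees are at least `S.card`. -/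
theorem natDegree_interpPoly_le {n : ℕ} (hn : 0 < n) {S : Finset (Fin (n + 1))} (f : ℝ → ℝ) :
    (interpPoly n S f).natDegree ≤ S.card :=
  natDegree_le_of_degree_le (Lagrange.degree_interpolate_lt _ (node_injective hn).injOn).le

theorem eval_nodalPoly_eq_zero_iff {n : ℕ} {S : Finset (Fin (n + 1))} {t : ℝ} :
    (nodalPoly n S).eval t = 0 ↔ t ∈ S.image (node n) := by
  rw [nodalPoly, Lagrange.eval_nodal, Finset.prod_eq_zero_iff]
  simp [sub_eq_zero, eq_comm]

theorem eval_nodalPoly_node_ne_zero {n : ℕ} (hn : 0 < n) {S : Finset (Fin (n + 1))}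
    {k : Fin (n + 1)} (hk : k ∉ S) : (nodalPoly n S).eval (node n k) ≠ 0 := by
  rw [Ne, eval_nodalPoly_eq_zero_iff, Finset.mem_image]
  rintro ⟨i, hi, h⟩
  exact hk (node_injective hn h ▸ hi)

theorem eval_derivative_nodalPoly_ne_zero {n : ℕ} (hn : 0 < n) {S : Finset (Fin (n + 1))}
    {i : Fin (n + 1)} (hi : i ∈ S) : (derivative (nodalPoly n S)).eval (node n i) ≠ 0 := by
  intro h
  have := Lagrange.nodalWeight_ne_zero (s := S) (v := node n) (node_injective hn).injOn hi
  rw [Lagrange.nodalWeight_eq_eval_derivative_nodal hi] at this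
  exact this (by rw [← nodalPoly, h, inv_zero])

/-- A polynomial vanishing at the nodes of `S` is a multiple of the nodal polynomial. -/
theorem exists_eq_nodalPoly_mul {n : ℕ} (hn : 0 < n) {S : Finset (Fin (n + 1))} {p : ℕ}
    {R : ℝ[X]} (hR : R.natDegree ≤ S.card + p) (h0 : ∀ i ∈ S, R.eval (node n i) = 0) :
    ∃ q : ℝ[X], q.natDegree ≤ p ∧ R = nodalPoly n S * q := by
  have hdvd : nodalPoly n S ∣ R := by
    rw [nodalPoly, Lagrange.nodal_eq]
    refine Finset.prod_dvd_of_coprime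
      ((pairwise_coprime_X_sub_C (node_injective hn)).set_pairwise _) fun i hi => ?_
    exact dvd_iff_isRoot.mpr (h0 i hi)
  obtain ⟨q, rfl⟩ := hdvd
  refine ⟨q, ?_, rfl⟩
  have hm : (nodalPoly n S).Monic := Lagrange.nodal_monic
  rcases eq_or_ne q 0 with rfl | hq
  · simp
  rw [hm.natDegree_mul' hq, nodalPoly, Lagrange.natDegree_nodal] at hR
  omega

/-- The quotient `(f - P_S) / ω_S` is continuous if `f` is differentiable. -/
theorem continuousOn_quotientFun {n : ℕ} (hn : 0 < n) (S : Finset (Fin (n + 1))) {f : ℝ → ℝ}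
    (hf : DifferentiableOn ℝ f (Set.Icc (-1) 1)) :
    ContinuousOn (quotientFun n S f) (Set.Icc (-1) 1) := by
  classical
  intro t ht
  -- On a punctured neighbourhood free of other nodes, only the plain quotient formula matters.
  rw [← continuousWithinAt_sdiff_self, ContinuousWithinAt]
  have hev : (fun s => (f s - (interpPoly n S f).eval s) / (nodalPoly n S).eval s) =ᶠ[
      nhdsWithin t (Set.Icc (-1) 1 \ {t})] quotientFun n S f := by
    have h1 : ((S.image (node n)).erase t : Set ℝ)ᶜ ∈ nhds t :=
      (Finset.finite_toSet _).isClosed.isOpen_compl.mem_nhds (by simp)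
    filter_upwards [mem_nhdsWithin_of_mem_nhds h1, self_mem_nhdsWithin] with s hs hs'
    have hs'' : s ∉ S.image (node n) := fun h =>
      hs (Finset.mem_coe.mpr (Finset.mem_erase.mpr ⟨hs'.2, h⟩))
    unfold quotientFun
    rw [if_neg (by convert hs'')]
  refine Filter.Tendsto.congr' hev ?_
  by_cases htS : t ∈ S.image (node n)
  · have hval : quotientFun n S f t =
        (derivWithin f (Set.Icc (-1) 1) t - (derivative (interpPoly n S f)).eval t) /
          (derivative (nodalPoly n S)).eval t := by
      unfold quotientFun
      rw [if_pos (by convert htS)]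
    rw [hval]
    obtain ⟨i, hi, rfl⟩ := Finset.mem_image.mp htS
    have hω0 : (nodalPoly n S).eval (node n i) = 0 := eval_nodalPoly_eq_zero_iff.mpr htS
    have hg := hasDerivWithinAt_iff_tendsto_slope.mp
      ((hf _ ht).hasDerivWithinAt.sub
        ((interpPoly n S f).hasDerivWithinAt (node n i) (Set.Icc (-1) 1)))
    have hω := hasDerivWithinAt_iff_tendsto_slope.mp
      ((nodalPoly n S).hasDerivWithinAt (node n i) (Set.Icc (-1) 1))
    -- At a node, numerator and denominator both vanish, so their quotient is a quotient of slopes.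
    refine (hg.div hω (eval_derivative_nodalPoly_ne_zero hn hi)).congr' ?_
    filter_upwards [self_mem_nhdsWithin] with s hs
    have hs0 : s - node n i ≠ 0 := sub_ne_zero.mpr hs.2
    simp only [slope_def_field, Pi.div_apply, Pi.sub_apply, hω0, eval_interpPoly hn f hi,
      sub_self, sub_zero]
    exact div_div_div_cancel_right₀ hs0 _ _
  · have hval : quotientFun n S f t =
        (f t - (interpPoly n S f).eval t) / (nodalPoly n S).eval t := by
      unfold quotientFun
      rw [if_neg (by convert htS)]
    rw [hval]
    have hc : ContinuousWithinAt (fun s => (f s - (interpPoly n S f).eval s) /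
        (nodalPoly n S).eval s) (Set.Icc (-1) 1) t :=
      ((hf t ht).continuousWithinAt.sub (interpPoly n S f).continuous.continuousWithinAt).div
        (nodalPoly n S).continuous.continuousWithinAt
        (fun h => htS (eval_nodalPoly_eq_zero_iff.mp h))
    exact hc.mono Set.sdiff_subset

/-- At a node both sides vanish, whatever value the quotient takes there. -/
theorem nodalPoly_mul_quotientFun {n : ℕ} (hn : 0 < n) (S : Finset (Fin (n + 1))) (f : ℝ → ℝ)
    (t : ℝ) :
    (nodalPoly n S).eval t * quotientFun n S f t = f t - (interpPoly n S f).eval t := by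
  classical
  by_cases htS : t ∈ S.image (node n)
  · obtain ⟨i, hi, rfl⟩ := Finset.mem_image.mp htS
    rw [eval_nodalPoly_eq_zero_iff.mpr htS, eval_interpPoly hn f hi, zero_mul, sub_self]
  · unfold quotientFun
    rw [if_neg (by convert htS)]
    exact mul_div_cancel₀ _ fun h => htS (eval_nodalPoly_eq_zero_iff.mp h)

/-- A polynomial of degree less than `#T` that is bounded by `M` at the nodes of `T` is bounded by
`‖I_T‖ M` on `[-1, 1]`. -/
theorem abs_eval_le_norm_interpOp_mul {n : ℕ} (hn : 0 < n) {T : Finset (Fin (n + 1))} {r : ℝ[X]}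
    (hr : r.degree < T.card) {M : ℝ} (hM : 0 ≤ M) (hrM : ∀ j ∈ T, |r.eval (node n j)| ≤ M)
    {t : ℝ} (ht : t ∈ Set.Icc (-1 : ℝ) 1) : |r.eval t| ≤ ‖interpOp n T‖ * M := by
  -- Clamping `r` to `[-M, M]` keeps its values on `T`, hence its interpolant, while forcing norm at
  -- most `M`.
  let φ : C(Seg, ℝ) := ⟨fun s => max (-M) (min M (r.eval s)), by fun_prop⟩
  have hφ : ‖φ‖ ≤ M := by
    refine (ContinuousMap.norm_le _ hM).mpr fun s => ?_
    rw [Real.norm_eq_abs, abs_le]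
    exact ⟨le_max_left _ _, max_le (by linarith) (min_le_left _ _)⟩
  have hφr : ∀ j ∈ T, φ ⟨node n j, node_mem n j⟩ = r.eval (node n j) := fun j hj => by
    have := abs_le.mp (hrM j hj)
    change max (-M) (min M (r.eval (node n j))) = _
    rw [min_eq_right this.2, max_eq_right this.1]
  have hI : interpOp n T φ ⟨t, ht⟩ = r.eval t := by
    have h1 := Lagrange.eq_interpolate (s := T) (node_injective hn).injOn hr
    conv_rhs => rw [h1, Lagrange.interpolate_apply, eval_finsetSum]
    simp only [interpOp, sum_apply, ContinuousMap.sum_apply]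
    refine Finset.sum_congr rfl fun j hj => ?_
    rw [eval_mul, eval_C, ← hφr j hj]
    rfl
  rw [← hI, ← Real.norm_eq_abs]
  calc _ ≤ ‖interpOp n T φ‖ := ContinuousMap.norm_coe_le_norm _ _
    _ ≤ ‖interpOp n T‖ * ‖φ‖ := ContinuousLinearMap.le_opNorm _ _
    _ ≤ _ := by gcongr

/-! ### The constrained least-squares problem -/

theorem IsConstrainedLeastSquares.eq {n : ℕ} (hn : 0 < n) {S T : Finset (Fin (n + 1))}
    (hT : T ⊆ Sᶜ) {f : ℝ → ℝ} {r : ℕ} (hr : r < S.card + T.card) {P Q : ℝ[X]}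
    (hP : IsConstrainedLeastSquares n S f r P) (hQ : IsConstrainedLeastSquares n S f r Q) :
    P = Q := by
  classical
  set H : ℝ[X] := C (1 / 2 : ℝ) * (P + Q) with hH
  have hHadm : IsAdmissible n S f r H := by
    refine ⟨(natDegree_C_mul_le _ _).trans
      (natDegree_add_le_of_degree_le hP.1.1 hQ.1.1), fun i hi => ?_⟩
    rw [hH, eval_mul, eval_C, eval_add, hP.1.2 i hi, hQ.1.2 i hi]
    ring
  have h1 := hP.2 H hHadm
  have h2 := hQ.2 H hHadm
  -- Parallelogram identity: the midpoint does no better than either minimizer, so `P` and `Q` agree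
  -- on `Sᶜ`, hence at the more than `r` nodes of `S ∪ T`.
  have h3 : ∑ k ∈ Sᶜ, (P.eval (node n k) - Q.eval (node n k)) ^ 2 =
      2 * ∑ k ∈ Sᶜ, (f (node n k) - P.eval (node n k)) ^ 2 +
      2 * ∑ k ∈ Sᶜ, (f (node n k) - Q.eval (node n k)) ^ 2 -
      4 * ∑ k ∈ Sᶜ, (f (node n k) - H.eval (node n k)) ^ 2 := by
    simp only [Finset.mul_sum, ← Finset.sum_add_distrib, ← Finset.sum_sub_distrib]
    refine Finset.sum_congr rfl fun k _ => ?_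
    rw [hH, eval_mul, eval_C, eval_add]
    ring
  have h4 : ∑ k ∈ Sᶜ, (P.eval (node n k) - Q.eval (node n k)) ^ 2 = 0 :=
    le_antisymm (by linarith) (Finset.sum_nonneg fun _ _ => sq_nonneg _)
  have h5 := (Finset.sum_eq_zero_iff_of_nonneg fun _ _ => sq_nonneg _).mp h4
  have hdisj : Disjoint S T := Finset.disjoint_right.mpr fun i hi =>
    Finset.mem_compl.mp (hT hi)
  have hcard : (S ∪ T).card = S.card + T.card := Finset.card_union_of_disjoint hdisj
  refine eq_of_degree_sub_lt_of_eval_index_eq (S ∪ T) (node_injective hn).injOn ?_ ?_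
  · refine (degree_le_of_natDegree_le
      ((natDegree_sub_le _ _).trans (max_le hP.1.1 hQ.1.1))).trans_lt ?_
    rw [hcard]
    exact_mod_cast hr
  · intro i hi
    rcases Finset.mem_union.mp hi with hi | hi
    · rw [hP.1.2 i hi, hQ.1.2 i hi]
    · exact sub_eq_zero.mp (pow_eq_zero_iff two_ne_zero |>.mp (h5 i (hT hi)))

/-- Orthogonal projection of the residual vector onto the grid values of polynomials vanishing on
`S`, a subspace of a finite-dimensional space. -/
theorem exists_isConstrainedLeastSquares {n : ℕ} (hn : 0 < n) (S : Finset (Fin (n + 1)))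
    (f : ℝ → ℝ) {r : ℕ} (hr : S.card ≤ r) : ∃ P, IsConstrainedLeastSquares n S f r P := by
  classical
  let V : Submodule ℝ ℝ[X] :=
    { carrier := {R | R.natDegree ≤ r ∧ ∀ i ∈ S, R.eval (node n i) = 0}
      add_mem' := fun {a b} ha hb => ⟨natDegree_add_le_of_degree_le ha.1 hb.1, fun i hi => by
        rw [eval_add, ha.2 i hi, hb.2 i hi, add_zero]⟩
      zero_mem' := ⟨by simp, fun i _ => eval_zero⟩
      smul_mem' := fun c a ha => ⟨(natDegree_smul_le _ _).trans ha.1, fun i hi => by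
        rw [eval_smul, ha.2 i hi, smul_zero]⟩ }
  let L : ℝ[X] →ₗ[ℝ] EuclideanSpace ℝ (Fin (n + 1)) :=
    { toFun := fun R => WithLp.toLp 2 fun i => R.eval (node n i)
      map_add' := fun a b => by ext i; simp
      map_smul' := fun c a => by ext i; simp }
  let u : EuclideanSpace ℝ (Fin (n + 1)) :=
    WithLp.toLp 2 fun i => f (node n i) - (interpPoly n S f).eval (node n i)
  have hsum : ∀ R ∈ V, ‖u - L R‖ ^ 2 = ∑ k ∈ Sᶜ,
      (f (node n k) - (interpPoly n S f + R).eval (node n k)) ^ 2 := by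
    intro R hR
    rw [EuclideanSpace.norm_sq_eq, ← Finset.sum_add_sum_compl S, Finset.sum_eq_zero, zero_add]
    · refine Finset.sum_congr rfl fun k _ => ?_
      simp only [u, L, Real.norm_eq_abs, sq_abs, eval_add, PiLp.sub_apply, LinearMap.coe_mk,
        AddHom.coe_mk]
      ring
    · intro i hi
      simp [u, L, eval_interpPoly hn f hi, hR.2 i hi]
  have hint := (natDegree_interpPoly_le hn (S := S) f).trans hr
  obtain ⟨_, ⟨R, hR, rfl⟩, hmin⟩ := (V.map L).exists_norm_eq_iInf_of_complete_subspace
    (Submodule.complete_of_finiteDimensional _) u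
  refine ⟨interpPoly n S f + R, ⟨natDegree_add_le_of_degree_le hint hR.1, fun i hi => ?_⟩,
    fun Q hQ => ?_⟩
  · rw [eval_add, eval_interpPoly hn f hi, hR.2 i hi, add_zero]
  have hQV : Q - interpPoly n S f ∈ V :=
    ⟨(natDegree_sub_le _ _).trans (max_le hQ.1 hint), fun i hi => by
      rw [eval_sub, hQ.2 i hi, eval_interpPoly hn f hi, sub_self]⟩
  have hle : ‖u - L R‖ ≤ ‖u - L (Q - interpPoly n S f)‖ := by
    rw [hmin]
    exact ciInf_le (f := fun w : ((V.map L : Submodule ℝ (EuclideanSpace ℝ (Fin (n + 1)))) :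
        Set (EuclideanSpace ℝ (Fin (n + 1)))) => ‖u - w‖)
      ⟨0, by rintro _ ⟨w, rfl⟩; exact norm_nonneg _⟩ ⟨_, Submodule.mem_map_of_mem hQV⟩
  have := pow_le_pow_left₀ (norm_nonneg _) hle 2
  rwa [hsum R hR, hsum _ hQV, add_sub_cancel] at this

/-- The error bound with the best approximation replaced by an arbitrary polynomial `Q`. -/
theorem IsConstrainedLeastSquares.abs_sub_eval_le {n : ℕ} (hn : 0 < n)
    {S T : Finset (Fin (n + 1))} (hT : T ⊆ Sᶜ) {p : ℕ} (hTcard : T.card = p + 1) {f : ℝ → ℝ}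
    (hf : DifferentiableOn ℝ f (Set.Icc (-1) 1)) {P Q : ℝ[X]}
    (hP : IsConstrainedLeastSquares n S f (S.card + p) P) (hQ : Q.natDegree ≤ p) {t : ℝ}
    (ht : t ∈ Set.Icc (-1 : ℝ) 1) :
    |f t - P.eval t| ≤ (1 + ‖interpOp n T‖ * (1 + √(∑ k ∈ Sᶜ, weight n S k) /
        ⨅ j : {j // j ∈ T}, √(weight n S j))) * supNorm (fun t => quotientFun n S f t - Q.eval t) *
      supNorm (fun t => (nodalPoly n S).eval t) := by
  set ω := nodalPoly n S with hω
  set g := quotientFun n S f with hg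
  set E := supNorm (fun t => g t - Q.eval t) with hE
  set W := ∑ k ∈ Sᶜ, weight n S k with hW
  set μ := ⨅ j : {j // j ∈ T}, √(weight n S j) with hμ
  have hE0 : 0 ≤ E := supNorm_nonneg _
  have hgE : ∀ s ∈ Set.Icc (-1 : ℝ) 1, |g s - Q.eval s| ≤ E := fun s hs =>
    le_supNorm ((continuousOn_quotientFun hn S hf).sub Q.continuous.continuousOn) hs
  have hωg := nodalPoly_mul_quotientFun hn S f
  have hωdeg : ω.natDegree = S.card := Lagrange.natDegree_nodal
  have hint : (interpPoly n S f).natDegree ≤ S.card + p :=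
    (natDegree_interpPoly_le hn f).trans (Nat.le_add_right _ _)
  obtain ⟨q, hq, hPq⟩ : ∃ q : ℝ[X], q.natDegree ≤ p ∧ P - interpPoly n S f = ω * q :=
    exists_eq_nodalPoly_mul hn ((natDegree_sub_le _ _).trans (max_le hP.1.1 hint)) fun i hi => by
      rw [eval_sub, hP.1.2 i hi, eval_interpPoly hn f hi, sub_self]
  have herr : ∀ (r R : ℝ[X]), R - interpPoly n S f = ω * r → ∀ s,
      f s - R.eval s = ω.eval s * (g s - r.eval s) := by
    intro r R h s
    have h1 := congrArg (eval s) h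
    rw [eval_sub, eval_mul] at h1
    linear_combination -(hωg s) - h1
  have hls : ∑ k ∈ Sᶜ, weight n S k * (g (node n k) - q.eval (node n k)) ^ 2 ≤ W * E ^ 2 := by
    -- The competitor whose quotient part is `Q`.
    have hadm : IsAdmissible n S f (S.card + p) (interpPoly n S f + ω * Q) := by
      refine ⟨natDegree_add_le_of_degree_le hint
        (natDegree_mul_le.trans (by omega)), fun i hi => ?_⟩
      rw [eval_add, eval_mul, eval_interpPoly hn f hi,
        eval_nodalPoly_eq_zero_iff.mpr (Finset.mem_image_of_mem _ hi), zero_mul, add_zero]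
    have h1 := hP.2 _ hadm
    simp only [herr q P hPq, herr Q (interpPoly n S f + ω * Q) (add_sub_cancel_left _ _),
      mul_pow] at h1
    refine h1.trans ?_
    rw [hW, Finset.sum_mul]
    refine Finset.sum_le_sum fun k _ => mul_le_mul_of_nonneg_left ?_ (sq_nonneg _)
    rw [← sq_abs]
    exact pow_le_pow_left₀ (abs_nonneg _) (hgE _ (node_mem n k)) 2
  have hne : Nonempty {j // j ∈ T} := by
    obtain ⟨j, hj⟩ := Finset.card_pos.mp (by omega : 0 < T.card)
    exact ⟨⟨j, hj⟩⟩
  have hμle : ∀ j ∈ T, μ ≤ √(weight n S j) := fun j hj =>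
    ciInf_le (f := fun j : {j // j ∈ T} => √(weight n S j)) (Set.finite_range _).bddBelow ⟨j, hj⟩
  -- The infimum over the finite nonempty `T` is attained, at a node outside `S`, where `ω` does not
  -- vanish.
  have hμ0 : 0 < μ := by
    obtain ⟨j, hj⟩ := exists_eq_ciInf_of_finite (f := fun j : {j // j ∈ T} => √(weight n S j))
    rw [hμ, ← hj]
    exact Real.sqrt_pos.mpr (sq_pos_of_ne_zero
      (eval_nodalPoly_node_ne_zero hn (Finset.mem_compl.mp (hT j.2))))
  have hnode : ∀ j ∈ T, |g (node n j) - q.eval (node n j)| ≤ √W / μ * E := by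
    intro j hj
    have h1 : weight n S j * (g (node n j) - q.eval (node n j)) ^ 2 ≤ W * E ^ 2 :=
      (Finset.single_le_sum (f := fun k => weight n S k *
        (g (node n k) - q.eval (node n k)) ^ 2)
        (fun k _ => mul_nonneg (sq_nonneg _) (sq_nonneg _)) (hT hj)).trans hls
    have h2 := Real.sqrt_le_sqrt h1
    rw [Real.sqrt_mul' _ (sq_nonneg _), Real.sqrt_sq_eq_abs, Real.sqrt_mul' _ (sq_nonneg _),
      Real.sqrt_sq hE0] at h2
    have h3 := (mul_le_mul_of_nonneg_right (hμle j hj) (abs_nonneg _)).trans h2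
    rw [div_mul_eq_mul_div, le_div_iff₀ hμ0]
    linarith
  have hr : |(Q - q).eval t| ≤ ‖interpOp n T‖ * ((1 + √W / μ) * E) := by
    refine abs_eval_le_norm_interpOp_mul hn ?_ (by positivity) (fun j hj => ?_) ht
    · refine (degree_le_of_natDegree_le
        ((natDegree_sub_le _ _).trans (max_le hQ hq))).trans_lt ?_
      rw [hTcard]
      exact_mod_cast Nat.lt_succ_self p
    · have h2 : (Q - q).eval (node n j) = (g (node n j) - q.eval (node n j)) -
          (g (node n j) - Q.eval (node n j)) := by rw [eval_sub]; ring
      rw [h2]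
      refine (abs_sub _ _).trans ?_
      linarith [hnode j hj, hgE _ (node_mem n j)]
  have hgq : |g t - q.eval t| ≤ (1 + ‖interpOp n T‖ * (1 + √W / μ)) * E := by
    have h2 : g t - q.eval t = (g t - Q.eval t) + (Q - q).eval t := by rw [eval_sub]; ring
    rw [h2]
    refine (abs_add_le _ _).trans ?_
    linarith [hgE t ht]
  rw [herr q P hPq t, abs_mul, mul_comm]
  exact mul_le_mul hgq (le_supNorm ω.continuous.continuousOn ht) (abs_nonneg _) (by positivity)

end MockChebyshev

end

theorem mainTheorem1 (d : ℝ) (hd : 0 < d) (p : ℕ) (hp : 1 ≤ p) :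
    ∃ D : ℝ, 0 < D ∧
      (∀ φ ∈ MockChebyshev.smoothClass d p,
        MockChebyshev.bestApproxError p φ ≤ D * ((p : ℝ) + 1) ^ (-(p : ℤ))) ∧
      ∀ (n : ℕ) (X' X''' : Finset (Fin (n + 1))),
        MockChebyshev.IsMockChebyshevSubset n X' →
        X''' ⊆ X'ᶜ → X'''.card = p + 1 →
        ∀ f ∈ MockChebyshev.smoothClass d p,
          (∃! P : Polynomial ℝ, MockChebyshev.IsConstrainedLeastSquares n X' f
            (MockChebyshev.mockDegree n + p + 1) P) ∧
          ∀ P : Polynomial ℝ,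
            MockChebyshev.IsConstrainedLeastSquares n X' f
              (MockChebyshev.mockDegree n + p + 1) P →
            MockChebyshev.supNorm (fun t => f t - P.eval t) ≤
              (1 + ‖MockChebyshev.interpOp n X'''‖ *
                (1 + D *
                  (Real.sqrt (∑ k ∈ X'ᶜ, MockChebyshev.weight n X' k) /
                    (⨅ j : {j // j ∈ X'''}, Real.sqrt (MockChebyshev.weight n X' j))) *
                  ((p : ℝ) + 1) ^ (-(p : ℤ)))) *
              MockChebyshev.bestApproxError p (MockChebyshev.quotientFun n X' f) *
              MockChebyshev.supNorm (fun t => (MockChebyshev.nodalPoly n X').eval t) := by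
  have hpow : (0 : ℝ) < ((p : ℝ) + 1) ^ p := by positivity
  have hD : ((p : ℝ) + 1) ^ p * (1 + d * 2 ^ p) * ((p : ℝ) + 1) ^ (-(p : ℤ)) = 1 + d * 2 ^ p := by
    rw [zpow_neg, zpow_natCast]
    field_simp
  -- Chosen so that `D (p+1)^(-p) = 1 + d 2^p`: the `1` serves the error bound, `d 2^p` the Taylor
  -- bound.
  refine ⟨((p : ℝ) + 1) ^ p * (1 + d * 2 ^ p), by positivity, fun φ hφ => ?_, ?_⟩
  · rw [hD]
    linarith [MockChebyshev.bestApproxError_le_of_mem_smoothClass hd hp hφ]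
  intro n X' X''' hX' hsub hcard f hf
  -- The `p + 1 ≥ 2` nodes of `X'''` rule out `n = 0`.
  have hn : 0 < n := by
    have h1 := hcard ▸ Finset.card_le_univ X'''
    rw [Fintype.card_fin] at h1
    omega
  have hX'card : X'.card = MockChebyshev.mockDegree n + 1 := by
    obtain ⟨σ, hσ, -, rfl⟩ := hX'
    rw [Finset.card_image_of_injective _ hσ, Finset.card_univ, Fintype.card_fin]
  have hdeg : MockChebyshev.mockDegree n + p + 1 = X'.card + p := by omega
  have hdiff : DifferentiableOn ℝ f (Set.Icc (-1) 1) :=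
    hf.1.differentiableOn (by exact_mod_cast (by omega : p ≠ 0))
  rw [hdeg]
  refine ⟨?_, fun P hP => ?_⟩
  · obtain ⟨P, hP⟩ := MockChebyshev.exists_isConstrainedLeastSquares hn X' f
      (Nat.le_add_right X'.card p)
    exact ⟨P, hP, fun Q hQ => hQ.eq hn hsub (by omega) hP⟩
  set A := Real.sqrt (∑ k ∈ X'ᶜ, MockChebyshev.weight n X' k) /
    (⨅ j : {j // j ∈ X'''}, Real.sqrt (MockChebyshev.weight n X' j)) with hA
  have hA0 : 0 ≤ A := div_nonneg (Real.sqrt_nonneg _) (Real.iInf_nonneg fun _ => Real.sqrt_nonneg _)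
  have hω0 := MockChebyshev.supNorm_nonneg (fun t => (MockChebyshev.nodalPoly n X').eval t)
  rw [mul_right_comm _ A, hD, mul_right_comm]
  refine MockChebyshev.le_mul_bestApproxError (by positivity) fun Q hQ => ?_
  refine MockChebyshev.supNorm_le fun t ht => (hP.abs_sub_eval_le hn hsub hcard hdiff hQ ht).trans ?_
  rw [← hA, mul_right_comm]
  have hA1 : A ≤ (1 + d * 2 ^ p) * A := le_mul_of_one_le_left hA0 (by
    linarith [show (0 : ℝ) < d * 2 ^ p by positivity])
  have hE0 := MockChebyshev.supNorm_nonneg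
    (fun t => MockChebyshev.quotientFun n X' f t - Q.eval t)
  gcongr
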